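/- Let $p$ be a prime and let $\varphi(x)=x^{p^2}+p^2x^{p^2+1}\in\mathbb{Q}[\![x]\!]$. There is a unique formal power series $f_\varphi(x)\in x+x^2\mathbb{Q}[\![x]\!]$ satisfying $\varphi(f_\varphi(x))=f_\varphi(x^{p^2})$ (the Böttcher coordinate of $\varphi$). It can be written as \[ f_\varphi(x)=x\sum_{k=0}^\infty \frac{a_k}{k!}x^k \] with integers $a_k\in\mathbb{Z}$, and \[ a_k\equiv -1 \pmod p \quad\text{for every } k=p^r,\ r\ge 0. \] -/

import Mathlib

open scoped PowerSeries

/-- `f` is a Böttcher coordinate of the power series `φ(x) = x ^ m + ⋯` over the field `K`: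
`f ∈ x + x² K⟦x⟧` and `φ ∘ f = f (x ^ m)`. Here `PowerSeries.subst a g` is the series
`g (a (x))`; both substitutions are legitimate for `m ≠ 0`, since `f` and `x ^ m` have zero
constant term. -/
structure IsBottcherCoordinate {K : Type*} [Field K] (m : ℕ) (φ f : K⟦X⟧) : Prop where
  coeff_zero : PowerSeries.coeff 0 f = 0
  coeff_one : PowerSeries.coeff 1 f = 1
  subst_eq : PowerSeries.subst f φ = PowerSeries.subst (PowerSeries.X ^ m : K⟦X⟧) f

/-!
Write `f = X * g` with `g = 1 + ⋯`. For `φ = X ^ m + c X ^ (m + 1)` the Böttcher equation becomes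
`g ^ m * (1 + c X g) = g (X ^ m)`. Changing the coefficient of `X ^ k` in `g` changes the equation
in degree `k` by `m` times that amount (`X_pow_succ_dvd_defect_add_sub`), so that the coefficients
of `g` are determined, and can be found, one after the other.

For the arithmetic let `m = c = p ^ 2`, and let `d = g' / g`. Differentiating the equation
logarithmically and cancelling `m` gives
`(1 + m f) * (d - X ^ (m - 1) * d (X ^ m)) = -f'` (`one_add_mul_logDeriv_sub`).
In terms of Hurwitz coefficients `n! * [X ^ n]`, products have integral structure constants, and the
term `X ^ (m - 1) * d (X ^ m)` only contributes multiples `n! / j!` of earlier coefficients of `d`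
with `n ≥ j + p`, which are divisible by `p`. Together with `g' = g * d` this shows by induction
that all Hurwitz coefficients are integers, and that modulo `p` the system collapses to `d = -f'`,
i.e. to `g = exp (-X g)`. The solution of the latter has the Hurwitz coefficients
`(-1) ^ n * (n + 1) ^ (n - 1)`, by Abel's binomial identity (`signedTree_succ`), and for `n = p ^ r`
these are congruent to `-1` modulo `p`.
-/

namespace BottcherCoordinate

/-! ### Abel's binomial identity -/

section Abel

open Polynomial

/-- The Abel polynomials `X * (X + n) ^ (n - 1)`, with value `1` for `n = 0`. -/
noncomputable def abelPoly : ℕ → ℚ[X]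
  | 0 => 1
  | n + 1 => X * (X + (((n + 1 : ℕ) : ℚ[X]))) ^ n

theorem derivative_abelPoly_succ (n : ℕ) :
    derivative (abelPoly (n + 1)) = ((n + 1 : ℕ) : ℚ[X]) * (abelPoly n).comp (X + 1) := by
  cases n with
  | zero => simp [abelPoly]
  | succ n =>
    simp only [abelPoly, derivative_mul, derivative_X, derivative_pow, derivative_add,
      derivative_natCast, mul_comp, pow_comp, add_comp, X_comp, natCast_comp, Nat.add_sub_cancel,
      map_natCast]
    push_cast
    ring

theorem eval_zero_abelPoly_succ (n : ℕ) : (abelPoly (n + 1)).eval 0 = 0 := by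
  simp [abelPoly]

/-- The Abel polynomials are of binomial type. By induction on the degree both sides have the same
derivative, and they agree at `0`. -/
theorem abelPoly_comp_X_add_C (y : ℚ) (n : ℕ) :
    ∑ k ∈ Finset.range (n + 1),
      (n.choose k : ℚ[X]) * C ((abelPoly k).eval y) * abelPoly (n - k) =
    (abelPoly n).comp (X + C y) := by
  induction n with
  | zero => simp [abelPoly]
  | succ n ih =>
    rw [← sub_eq_zero]
    set P : ℚ[X] := ∑ k ∈ Finset.range (n + 1 + 1),
      ((n + 1).choose k : ℚ[X]) * C ((abelPoly k).eval y) * abelPoly (n + 1 - k) -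
        (abelPoly (n + 1)).comp (X + C y) with hP
    have hd : derivative P = 0 := by
      rw [hP, derivative_sub, sub_eq_zero, derivative_comp, derivative_abelPoly_succ, derivative_sum,
        Finset.sum_range_succ]
      have ih' := congrArg (fun q => ((n + 1 : ℕ) : ℚ[X]) * q.comp (X + 1)) ih
      simp only [comp_assoc, mul_comp, natCast_comp, add_comp, X_comp, one_comp, C_comp] at ih' ⊢
      rw [derivative_add, derivative_X, derivative_C, add_zero, one_mul,
        show X + C y + 1 = X + 1 + C y by ring, ← ih', Polynomial.sum_comp, Finset.mul_sum]
      have h0 : derivative (((n + 1).choose (n + 1) : ℚ[X]) * C ((abelPoly (n + 1)).eval y) *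
          abelPoly (n + 1 - (n + 1))) = 0 := by
        rw [Nat.sub_self, derivative_mul, derivative_natCast_mul, derivative_C]
        simp only [abelPoly, derivative_one, mul_zero, zero_mul, add_zero]
      rw [h0, add_zero]
      refine Finset.sum_congr rfl fun k hk => ?_
      have hk : k ≤ n := by simpa [Nat.lt_succ_iff] using hk
      rw [Nat.succ_sub hk, mul_assoc, derivative_natCast_mul, derivative_C_mul,
        derivative_abelPoly_succ]
      have hc : ((n + 1).choose k : ℚ[X]) * ((n - k + 1 : ℕ) : ℚ[X]) =
          ((n + 1 : ℕ) : ℚ[X]) * (n.choose k : ℚ[X]) := by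
        have := Nat.choose_mul_succ_eq n k
        rw [Nat.succ_sub hk, mul_comm, mul_comm] at this
        exact_mod_cast (by lia)
      simp only [mul_comp, natCast_comp, C_comp]
      linear_combination C ((abelPoly k).eval y) * (abelPoly (n - k)).comp (X + 1) * hc
    have h0 : eval 0 P = 0 := by
      rw [hP, eval_sub, eval_finsetSum, Finset.sum_range_succ, Finset.sum_eq_zero]
      · simp [abelPoly]
      · intro k hk
        have hk : k ≤ n := by simpa [Nat.lt_succ_iff] using hk
        rw [Nat.succ_sub hk, eval_mul, eval_zero_abelPoly_succ, mul_zero]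
    rw [eq_C_of_derivative_eq_zero hd, coeff_zero_eq_eval_zero]
    simp [h0]

/-- The number `(n + 1) ^ (n - 1)` of labelled trees on `n + 1` vertices, with sign `(-1) ^ n`: these
are the Hurwitz coefficients of the solution of `g = exp (-X * g)`. The truncated exponent at `n = 0`
is harmless, as the base is `1`. -/
def signedTree (n : ℕ) : ℤ := (-1) ^ n * (n + 1) ^ (n - 1)

theorem eval_one_abelPoly (n : ℕ) : (abelPoly n).eval 1 = (-1) ^ n * (signedTree n : ℚ) := by
  have h : ((-1 : ℚ) ^ n) * (-1) ^ n = 1 := by rw [← mul_pow]; simp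
  cases n with
  | zero => simp [abelPoly, signedTree]
  | succ n =>
    simp only [abelPoly, signedTree, eval_mul, eval_pow, eval_add, eval_X, eval_natCast]
    push_cast
    rw [← mul_assoc, h]
    ring

theorem eval_two_abelPoly (n : ℕ) : ((n : ℚ) + 2) * (abelPoly n).eval 2 = 2 * (n + 2) ^ n := by
  cases n with
  | zero => simp [abelPoly]
  | succ n =>
    simp only [abelPoly, eval_mul, eval_pow, eval_add, eval_X, eval_natCast]
    push_cast
    ring

/-- The recursion for the Hurwitz coefficients encoded in `g' = -(X * g)' * g`. -/
theorem signedTree_succ (n : ℕ) :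
    signedTree (n + 1) = ∑ i ∈ Finset.range (n + 1),
      (n.choose i : ℤ) * signedTree i * (-((n - i : ℕ) + 1) * signedTree (n - i)) := by
  have hA := congrArg (eval 1) (abelPoly_comp_X_add_C 1 n)
  simp only [eval_finsetSum, eval_mul, eval_natCast, eval_C, eval_comp, eval_add, eval_X] at hA
  rw [show (1 : ℚ) + 1 = 2 by norm_num] at hA
  set T : ℚ := ∑ i ∈ Finset.range (n + 1),
    (n.choose i : ℚ) * signedTree i * signedTree (n - i) with hT
  have hAT : (abelPoly n).eval 2 = (-1) ^ n * T := by
    rw [← hA, hT, Finset.mul_sum]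
    refine Finset.sum_congr rfl fun i hi => ?_
    have hi : i ≤ n := by simpa [Nat.lt_succ_iff] using hi
    have hs : (-1 : ℚ) ^ n = (-1) ^ i * (-1) ^ (n - i) := by
      rw [← pow_add, Nat.add_sub_cancel' hi]
    rw [eval_one_abelPoly, eval_one_abelPoly, hs]
    ring
  -- Weighting a term with `n - i + 1` or, after reflection, with `i + 1` gives the same sum.
  have hrefl : ∑ i ∈ Finset.range (n + 1),
        (n.choose i : ℚ) * signedTree i * (((n - i : ℕ) + 1) * signedTree (n - i)) =
      ∑ i ∈ Finset.range (n + 1),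
        (n.choose i : ℚ) * signedTree i * ((i + 1) * signedTree (n - i)) := by
    rw [← Finset.sum_range_reflect]
    refine Finset.sum_congr rfl fun i hi => ?_
    have hi : i ≤ n := by simpa [Nat.lt_succ_iff] using hi
    rw [Nat.add_sub_cancel, Nat.sub_sub_self hi, Nat.choose_symm hi]
    ring
  have hadd : ∑ i ∈ Finset.range (n + 1),
        (n.choose i : ℚ) * signedTree i * (((n - i : ℕ) + 1) * signedTree (n - i)) +
      ∑ i ∈ Finset.range (n + 1),
        (n.choose i : ℚ) * signedTree i * ((i + 1) * signedTree (n - i)) = (n + 2) * T := by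
    rw [← Finset.sum_add_distrib, hT, Finset.mul_sum]
    refine Finset.sum_congr rfl fun i hi => ?_
    have hi : i ≤ n := by simpa [Nat.lt_succ_iff] using hi
    rw [Nat.cast_sub hi]
    ring
  have h2 := eval_two_abelPoly n
  have hsq : ((-1 : ℚ) ^ n) * (-1) ^ n = 1 := by rw [← mul_pow]; simp
  have key : (signedTree (n + 1) : ℚ) = -∑ i ∈ Finset.range (n + 1),
      (n.choose i : ℚ) * signedTree i * (((n - i : ℕ) + 1) * signedTree (n - i)) := by
    have hb : (signedTree (n + 1) : ℚ) = -((-1) ^ n * (n + 2) ^ n) := by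
      rw [signedTree, Nat.add_sub_cancel]
      push_cast
      ring
    rw [hAT] at h2
    rw [hb]
    linear_combination (1 / 2 * (-1) ^ n) * h2 + (1 / 2) * hadd + (1 / 2) * hrefl -
      (n + 2) * T / 2 * hsq
  have hfin : ((signedTree (n + 1) : ℤ) : ℚ) = ((∑ i ∈ Finset.range (n + 1),
      (n.choose i : ℤ) * signedTree i * (-((n - i : ℕ) + 1) * signedTree (n - i)) : ℤ) : ℚ) := by
    rw [key, ← Finset.sum_neg_distrib]
    push_cast
    refine Finset.sum_congr rfl fun i _ => ?_
    ring
  exact_mod_cast hfin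

theorem signedTree_prime_pow {p : ℕ} (hp : p.Prime) (r : ℕ) :
    signedTree (p ^ r) ≡ -1 [ZMOD p] := by
  have := Fact.mk hp
  rw [← ZMod.intCast_eq_intCast_iff, signedTree]
  push_cast
  -- Fermat's `x ^ p ^ r = x` in `ZMod p` gives `(-1) ^ p ^ r = -1`, also for `p = 2`.
  rw [ZMod.pow_card_pow]
  rcases r.eq_zero_or_pos with rfl | hr
  · simp
  · simp [hr.ne']

end Abel

end BottcherCoordinate

open PowerSeries

namespace BottcherCoordinate

/-! ### Existence and uniqueness -/

section Existence

variable {K : Type*} [Field K] {m : ℕ}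

/-- For `f = X * g`, the difference of the two sides of the Böttcher equation of
`X ^ m + c X ^ (m + 1)` is `X ^ m * defect hm c g`. -/
noncomputable def defect (hm : m ≠ 0) (c : K) (g : K⟦X⟧) : K⟦X⟧ :=
  g ^ m * (1 + C c * X * g) - expand m hm g

theorem isBottcherCoordinate_X_mul_iff (hm : m ≠ 0) (c : K) (g : K⟦X⟧) :
    IsBottcherCoordinate m (X ^ m + C c * X ^ (m + 1)) (X * g) ↔
      constantCoeff g = 1 ∧ defect hm c g = 0 := by
  have hs : HasSubst (X * g : K⟦X⟧) := HasSubst.of_constantCoeff_zero' (by simp)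
  have h1 : subst (X * g) (X ^ m + C c * X ^ (m + 1) : K⟦X⟧) =
      X ^ m * (g ^ m * (1 + C c * X * g)) := by
    rw [subst_add hs, subst_mul hs, subst_pow hs, subst_pow hs, subst_X hs, subst_C]
    change (X * g) ^ m + C c * (X * g) ^ (m + 1) = _
    ring
  have h2 : subst (X ^ m : K⟦X⟧) (X * g) = X ^ m * expand m hm g := by
    rw [← expand_apply m hm, map_mul, expand_X]
  have h3 : subst (X * g) (X ^ m + C c * X ^ (m + 1) : K⟦X⟧) = subst (X ^ m : K⟦X⟧) (X * g) ↔
      defect hm c g = 0 := by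
    rw [h1, h2, mul_right_inj' (pow_ne_zero _ X_ne_zero), defect, sub_eq_zero]
  have h4 : coeff 1 (X * g) = constantCoeff g := by
    simp
  constructor
  · rintro ⟨-, h, h'⟩
    exact ⟨h4 ▸ h, h3.1 h'⟩
  · rintro ⟨h, h'⟩
    exact ⟨by simp, h4.trans h, h3.2 h'⟩

theorem exists_eq_X_mul {φ f : K⟦X⟧} (h : IsBottcherCoordinate m φ f) : ∃ g, f = X * g :=
  X_dvd_iff.2 (by simpa using h.coeff_zero)

/-- Changing `u = 1 + ⋯` in degree `k` changes the defect in degree `k` by `m` times as much: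
the factor `u ^ m` contributes `m`, and all other contributions have higher degree. -/
theorem X_pow_succ_dvd_defect_add_sub (hm : 2 ≤ m) (c : K) {u : K⟦X⟧}
    (hu : constantCoeff u = 1) (w : K⟦X⟧) {k : ℕ} (hk : 1 ≤ k) :
    X ^ (k + 1) ∣ defect (by lia : m ≠ 0) c (u + X ^ k * w) - defect (by lia : m ≠ 0) c u -
      (m : K⟦X⟧) * X ^ k * w := by
  obtain ⟨v, hv⟩ : X ∣ u ^ (m - 1) - 1 := X_dvd_iff.2 (by simp [hu])
  obtain ⟨z, hz⟩ := Polynomial.powAddExpansion u (X ^ k * w) m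
  obtain ⟨l, rfl⟩ : ∃ l, k = l + 1 := ⟨k - 1, by lia⟩
  obtain ⟨j, hj⟩ : ∃ j, m * (l + 1) = (l + 1 + 1) + j :=
    ⟨m * (l + 1) - (l + 2), by
      have := Nat.mul_le_mul_right (l + 1) hm
      lia⟩
  have hv' : u ^ (m - 1) = 1 + X * v := by rw [← hv]; ring
  have he : expand m (by lia : m ≠ 0) (X ^ (l + 1) * w) =
      X ^ (l + 1 + 1) * X ^ j * expand m (by lia : m ≠ 0) w := by
    rw [map_mul, map_pow, expand_X, ← pow_mul, hj, pow_add]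
  simp only [defect, map_add, he, hz, hv']
  refine ⟨(m : K⟦X⟧) * v * w + z * X ^ l * w ^ 2 +
    C c * (u + X ^ (l + 1) * w) * ((m : K⟦X⟧) * (1 + X * v) * w + z * X ^ (l + 1) * w ^ 2) +
    C c * u ^ m * w - X ^ j * expand m (by lia : m ≠ 0) w, ?_⟩
  ring

theorem eq_of_defect_eq_zero (hm : 2 ≤ m) (hmK : (m : K) ≠ 0) (c : K) {u v : K⟦X⟧}
    (hu : constantCoeff u = 1) (hv : constantCoeff v = 1)
    (hdu : defect (by lia : m ≠ 0) c u = 0) (hdv : defect (by lia : m ≠ 0) c v = 0) :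
    u = v := by
  have key : ∀ k, X ^ (k + 1) ∣ v - u := by
    intro k
    induction k with
    | zero => simp [X_dvd_iff, hu, hv]
    | succ k ih =>
      obtain ⟨w, hw⟩ := ih
      obtain rfl : v = u + X ^ (k + 1) * w := by rw [← hw]; ring
      obtain ⟨z, hz⟩ := X_pow_succ_dvd_defect_add_sub hm c hu w (by lia : 1 ≤ k + 1)
      rw [hdu, hdv, sub_self, zero_sub] at hz
      have hz' : -((m : K⟦X⟧) * w) = X * z := by
        refine mul_left_cancel₀ (pow_ne_zero (k + 1) X_ne_zero) ?_
        linear_combination hz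
      have h0 := congrArg constantCoeff hz'
      simp only [map_neg, map_mul, map_natCast, constantCoeff_X, zero_mul, neg_eq_zero,
        mul_eq_zero, hmK, false_or] at h0
      rw [hw, pow_succ X (k + 1)]
      exact mul_dvd_mul_left _ (X_dvd_iff.2 h0)
  ext n
  have := X_pow_dvd_iff.1 (key n) n (by lia)
  rw [map_sub, sub_eq_zero] at this
  exact this.symm

/-- Successive approximations to a zero of the defect: the `k`-th one makes the defect vanish up to
degree `k`. -/
noncomputable def approx (hm : m ≠ 0) (c : K) : ℕ → K⟦X⟧
  | 0 => 1
  | k + 1 => approx hm c k +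
      X ^ (k + 1) * C (-coeff (k + 1) (defect hm c (approx hm c k)) / m)

theorem constantCoeff_approx (hm : m ≠ 0) (c : K) (k : ℕ) :
    constantCoeff (approx hm c k) = 1 := by
  induction k with
  | zero => simp [approx]
  | succ k ih => simp [approx, ih]

theorem X_pow_dvd_defect_approx (hm : 2 ≤ m) (hmK : (m : K) ≠ 0) (c : K) (k : ℕ) :
    X ^ (k + 1) ∣ defect (by lia : m ≠ 0) c (approx (by lia : m ≠ 0) c k) := by
  induction k with
  | zero => simp [approx, defect]
  | succ k ih =>
    have hd := X_pow_succ_dvd_defect_add_sub hm c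
      (constantCoeff_approx (by lia : m ≠ 0) c k)
      (C (-coeff (k + 1) (defect (by lia : m ≠ 0) c (approx (by lia : m ≠ 0) c k)) / (m : K)))
      (by lia : 1 ≤ k + 1)
    rw [X_pow_dvd_iff] at hd ih ⊢
    intro n hn
    have h := hd n hn
    rw [approx]
    rw [map_sub, map_sub, sub_sub, sub_eq_zero] at h
    rw [h, mul_assoc, ← map_natCast (C (R := K)), coeff_C_mul, mul_comm (X ^ _), coeff_C_mul,
      coeff_X_pow]
    split_ifs with hnk
    · subst hnk
      field_simp
      ring
    · rw [ih n (by lia)]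
      ring

theorem coeff_approx_of_le (hm : m ≠ 0) (c : K) {n k : ℕ} (h : n ≤ k) :
    coeff n (approx hm c k) = coeff n (approx hm c n) := by
  induction k, h using Nat.le_induction with
  | base => rfl
  | succ k hk ih =>
    rw [approx, map_add, ih, mul_comm, coeff_C_mul, coeff_X_pow, if_neg (by lia)]
    ring

theorem exists_defect_eq_zero (hm : 2 ≤ m) (hmK : (m : K) ≠ 0) (c : K) :
    ∃ g : K⟦X⟧, constantCoeff g = 1 ∧ defect (by lia : m ≠ 0) c g = 0 := by
  set G : ℕ → K⟦X⟧ := approx (by lia : m ≠ 0) c with hG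
  refine ⟨mk fun k => coeff k (G k), ?_, ?_⟩
  · rw [← coeff_zero_eq_constantCoeff_apply, coeff_mk, coeff_zero_eq_constantCoeff_apply]
    exact constantCoeff_approx _ _ _
  · ext n
    obtain ⟨w, hw⟩ : X ^ (n + 1) ∣ (mk fun k => coeff k (G k)) - G n := by
      rw [X_pow_dvd_iff]
      intro j hj
      rw [map_sub, coeff_mk, hG, coeff_approx_of_le _ _ (by lia : j ≤ n), sub_self]
    have hw' : (mk fun k => coeff k (G k)) = G n + X ^ (n + 1) * w := by rw [← hw]; ring
    have h1 := (pow_dvd_pow X (by lia : n + 1 ≤ n + 1 + 1)).trans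
      (X_pow_succ_dvd_defect_add_sub hm c (constantCoeff_approx (by lia : m ≠ 0) c n) w
        (by lia : 1 ≤ n + 1))
    have h2 : X ^ (n + 1) ∣ (m : K⟦X⟧) * X ^ (n + 1) * w :=
      Dvd.intro (m * w) (by ring)
    have h3 := (dvd_add ((dvd_add h1 h2)) (X_pow_dvd_defect_approx hm hmK c n))
    rw [sub_add_cancel, sub_add_cancel] at h3
    rw [hw', map_zero]
    exact X_pow_dvd_iff.1 h3 n (by lia)

theorem existsUnique_isBottcherCoordinate (hm : 2 ≤ m) (hmK : (m : K) ≠ 0) (c : K) :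
    ∃! f : K⟦X⟧, IsBottcherCoordinate m (X ^ m + C c * X ^ (m + 1)) f := by
  obtain ⟨g, hg, hdg⟩ := exists_defect_eq_zero hm hmK c
  refine ⟨X * g, (isBottcherCoordinate_X_mul_iff _ c g).2 ⟨hg, hdg⟩, fun f hf => ?_⟩
  obtain ⟨h, rfl⟩ := exists_eq_X_mul hf
  obtain ⟨hh, hdh⟩ := (isBottcherCoordinate_X_mul_iff (by lia : m ≠ 0) c h).1 hf
  rw [eq_of_defect_eq_zero hm hmK c hh hg hdh hdg]

end Existence

/-! ### The logarithmic derivative of the functional equation -/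

/-- The Böttcher equation for `X * g`, differentiated logarithmically, in terms of `d = g' / g`. -/
theorem one_add_mul_logDeriv_sub {K : Type*} [Field K] {m : ℕ} (hm : m ≠ 0) (hmK : (m : K) ≠ 0)
    {g d : K⟦X⟧} (hg : constantCoeff g = 1) (hdef : defect hm (m : K) g = 0)
    (hd : d⁄dX K g = g * d) :
    (1 + (m : K⟦X⟧) * (X * g)) * (d - X ^ (m - 1) * expand m hm d) = -d⁄dX K (X * g) := by
  have hexp : d⁄dX K (expand m hm g) =
      expand m hm (g * d) * ((m : K⟦X⟧) * X ^ (m - 1)) := by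
    rw [expand_apply, derivative_subst (HasSubst.X_pow hm), hd, ← expand_apply m hm,
      derivative_pow, derivative_X, mul_one]
  have hE : expand m hm g = g ^ m * (1 + (m : K⟦X⟧) * (X * g)) := by
    rw [defect, sub_eq_zero, map_natCast] at hdef
    rw [← hdef, mul_assoc]
  have hD := congrArg (d⁄dX K) hE
  have hgm : g ^ m = g ^ (m - 1) * g := by rw [← pow_succ, Nat.sub_add_cancel (by lia)]
  have hmd : d⁄dX K (m : K⟦X⟧) = 0 := by rw [← map_natCast (C (R := K)), derivative_C]
  rw [hexp, map_mul, hE, Derivation.leibniz, map_add, Derivation.leibniz (d⁄dX K) (m : K⟦X⟧),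
    hmd, derivative_one, derivative_pow, hd] at hD
  simp only [smul_eq_mul] at hD
  have hg0 : g ≠ 0 := by rintro rfl; simp at hg
  have hm0 : (m : K⟦X⟧) ≠ 0 := fun h => hmK (by simpa using congrArg constantCoeff h)
  refine mul_left_cancel₀ (mul_ne_zero hm0 (pow_ne_zero m hg0)) ?_
  rw [hgm] at hD ⊢
  linear_combination -hD

/-! ### Integrality and congruence of the Hurwitz coefficients -/

section Integrality

/-- `x` is an integer congruent to `b` modulo `p`. -/
def IsIntModEq (p : ℕ) (x : ℚ) (b : ℤ) : Prop := ∃ a : ℤ, x = a ∧ a ≡ b [ZMOD p]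

namespace IsIntModEq

variable {p : ℕ} {x y : ℚ} {b c : ℤ}

theorem intCast (p : ℕ) (b : ℤ) : IsIntModEq p b b := ⟨b, rfl, rfl⟩

theorem add (hx : IsIntModEq p x b) (hy : IsIntModEq p y c) : IsIntModEq p (x + y) (b + c) := by
  obtain ⟨s, rfl, hs⟩ := hx
  obtain ⟨t, rfl, ht⟩ := hy
  exact ⟨s + t, by push_cast; rfl, hs.add ht⟩

theorem mul (hx : IsIntModEq p x b) (hy : IsIntModEq p y c) : IsIntModEq p (x * y) (b * c) := by
  obtain ⟨s, rfl, hs⟩ := hx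
  obtain ⟨t, rfl, ht⟩ := hy
  exact ⟨s * t, by push_cast; rfl, hs.mul ht⟩

theorem sum {ι : Type*} {s : Finset ι} {x : ι → ℚ} {b : ι → ℤ}
    (h : ∀ i ∈ s, IsIntModEq p (x i) (b i)) : IsIntModEq p (∑ i ∈ s, x i) (∑ i ∈ s, b i) := by
  classical
  induction s using Finset.induction_on with
  | empty => exact ⟨0, by simp, by simp⟩
  | insert i s hi ih =>
    rw [Finset.sum_insert hi, Finset.sum_insert hi]
    exact (h i (by simp)).add (ih fun j hj => h j (by simp [hj]))

theorem natCast_mul_of_dvd {n : ℕ} (h : p ∣ n) (hx : IsIntModEq p x b) :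
    IsIntModEq p (n * x) 0 := by
  have hn : IsIntModEq p (n : ℚ) 0 :=
    ⟨n, by simp, (Int.modEq_zero_iff_dvd).2 (Int.natCast_dvd_natCast.2 h)⟩
  simpa using hn.mul hx

end IsIntModEq

/-- The Hurwitz coefficient `n! * a_n` of `∑ a_n X ^ n`. -/
noncomputable def hurwitzCoeff (n : ℕ) (u : ℚ⟦X⟧) : ℚ := n.factorial * coeff n u

theorem hurwitzCoeff_add (n : ℕ) (u v : ℚ⟦X⟧) :
    hurwitzCoeff n (u + v) = hurwitzCoeff n u + hurwitzCoeff n v := by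
  rw [hurwitzCoeff, map_add, mul_add, ← hurwitzCoeff, ← hurwitzCoeff]

theorem hurwitzCoeff_mul (n : ℕ) (u v : ℚ⟦X⟧) :
    hurwitzCoeff n (u * v) = ∑ i ∈ Finset.range (n + 1),
      (n.choose i : ℚ) * hurwitzCoeff i u * hurwitzCoeff (n - i) v := by
  rw [hurwitzCoeff, coeff_mul, Finset.Nat.sum_antidiagonal_eq_sum_range_succ_mk, Finset.mul_sum]
  refine Finset.sum_congr rfl fun i hi => ?_
  have hi : i ≤ n := by simpa [Nat.lt_succ_iff] using hi
  have h : (n.factorial : ℚ) = n.choose i * i.factorial * (n - i).factorial := by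
    exact_mod_cast (Nat.choose_mul_factorial_mul_factorial hi).symm
  rw [h, hurwitzCoeff, hurwitzCoeff]
  ring

theorem hurwitzCoeff_derivative (n : ℕ) (u : ℚ⟦X⟧) :
    hurwitzCoeff n (d⁄dX ℚ u) = hurwitzCoeff (n + 1) u := by
  rw [hurwitzCoeff, hurwitzCoeff, coeff_derivative, Nat.factorial_succ]
  push_cast
  ring

theorem hurwitzCoeff_succ_X_mul (n : ℕ) (u : ℚ⟦X⟧) :
    hurwitzCoeff (n + 1) (X * u) = (n + 1 : ℕ) * hurwitzCoeff n u := by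
  rw [hurwitzCoeff, hurwitzCoeff, coeff_succ_X_mul, Nat.factorial_succ]
  push_cast
  ring

theorem mul_factorial_dvd_factorial {p j n : ℕ} (hp : p ≠ 0) (h : j + p ≤ n) :
    p * j.factorial ∣ n.factorial :=
  calc p * j.factorial ∣ p.factorial * j.factorial :=
        Nat.mul_dvd_mul_right (Nat.dvd_factorial (Nat.pos_of_ne_zero hp) le_rfl) _
    _ ∣ (p + j).factorial := Nat.factorial_mul_factorial_dvd_factorial_add p j
    _ ∣ n.factorial := Nat.factorial_dvd_factorial (by lia)

/-- The only Hurwitz coefficients of `X ^ (m - 1) * d (X ^ m)` that can be nonzero have degree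
`n = m * (j + 1) - 1`, and equal `n! / j!` times the `j`-th one of `d`. As `n ≥ j + p`, the factor
`n! / j!` is divisible by `p`. -/
theorem IsIntModEq.hurwitzCoeff_X_pow_mul_expand {p m : ℕ} (hp : p ≠ 0) (hpm : p + 1 ≤ m)
    {d : ℚ⟦X⟧} {n : ℕ} {b : ℕ → ℤ} (hd : ∀ j < n, IsIntModEq p (hurwitzCoeff j d) (b j)) :
    IsIntModEq p (hurwitzCoeff n (X ^ (m - 1) * expand m (by lia) d)) 0 := by
  have hzero : IsIntModEq p 0 0 := ⟨0, by simp, rfl⟩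
  rw [hurwitzCoeff, coeff_X_pow_mul', coeff_expand]
  split_ifs with h1 h2
  · obtain ⟨j, hj⟩ := h2
    rw [hj, Nat.mul_div_cancel_left _ (by lia)]
    have hmul : (p + 1) * j ≤ m * j := Nat.mul_le_mul_right j hpm
    have hle : j ≤ p * j := Nat.le_mul_of_pos_left j (Nat.pos_of_ne_zero hp)
    have hjn : j + p ≤ n := by lia
    obtain ⟨t, ht⟩ := mul_factorial_dvd_factorial hp hjn
    have h : (n.factorial : ℚ) * coeff j d = (p * t : ℕ) * hurwitzCoeff j d := by
      rw [ht, hurwitzCoeff]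
      push_cast
      ring
    rw [h]
    exact natCast_mul_of_dvd (dvd_mul_right p t) (hd j (by lia))
  · simpa using hzero
  · simpa using hzero

/-- If `X * g` is a Böttcher coordinate of `X ^ m + m X ^ (m + 1)`, the Hurwitz coefficients of `g`
are integers, and modulo `p` they are those of the solution of `g = exp (-X * g)`. -/
theorem isIntModEq_hurwitzCoeff_signedTree {p m : ℕ} (hp : p ≠ 0) (hpm : p + 1 ≤ m) (hdvd : p ∣ m)
    {g : ℚ⟦X⟧} (hg : constantCoeff g = 1) (hdef : defect (by lia : m ≠ 0) (m : ℚ) g = 0) (n : ℕ) :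
    IsIntModEq p (hurwitzCoeff n g) (signedTree n) := by
  have hmQ : (m : ℚ) ≠ 0 := by exact_mod_cast (by lia : m ≠ 0)
  set d : ℚ⟦X⟧ := g⁻¹ * d⁄dX ℚ g with hd_def
  have hd : d⁄dX ℚ g = g * d := by
    rw [hd_def, ← mul_assoc, PowerSeries.mul_inv_cancel _ (by rw [hg]; exact one_ne_zero), one_mul]
  have hode := one_add_mul_logDeriv_sub (by lia : m ≠ 0) hmQ hg hdef hd
  set e : ℚ⟦X⟧ := d - X ^ (m - 1) * expand m (by lia) d with he
  have hde : d = e + X ^ (m - 1) * expand m (by lia) d := by rw [he]; ring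
  have hrec : ∀ n, hurwitzCoeff n e = (-((n : ℤ) + 1) : ℤ) * hurwitzCoeff n g +
      (m : ℚ) * ((-1 : ℤ) * ∑ i ∈ Finset.range n, (n.choose (i + 1) : ℤ) *
        (((i + 1 : ℕ) : ℤ) * hurwitzCoeff i g) * hurwitzCoeff (n - (i + 1)) e) := by
    intro n
    have h := congrArg (hurwitzCoeff n) hode
    have hl : hurwitzCoeff n ((1 + (m : ℚ⟦X⟧) * (X * g)) * e) =
        hurwitzCoeff n e + m * hurwitzCoeff n (X * g * e) := by
      rw [add_mul, one_mul, mul_assoc (m : ℚ⟦X⟧), ← map_natCast (C (R := ℚ)), hurwitzCoeff,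
        map_add, coeff_C_mul, hurwitzCoeff, hurwitzCoeff]
      ring
    have hr : hurwitzCoeff n (-d⁄dX ℚ (X * g)) = -((n + 1 : ℕ) * hurwitzCoeff n g) := by
      rw [← hurwitzCoeff_succ_X_mul, ← hurwitzCoeff_derivative, hurwitzCoeff, hurwitzCoeff, map_neg,
        mul_neg]
    have h0 : hurwitzCoeff 0 (X * g) = 0 := by simp [hurwitzCoeff]
    rw [hl, hr, hurwitzCoeff_mul, Finset.sum_range_succ', h0, mul_zero, zero_mul, add_zero] at h
    simp only [hurwitzCoeff_succ_X_mul] at h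
    push_cast at h ⊢
    linear_combination h
  have hnat : ∀ k : ℕ, IsIntModEq p ((k : ℤ) : ℚ) k := fun k => .intCast p k
  have main : ∀ n, IsIntModEq p (hurwitzCoeff n g) (signedTree n) ∧
      IsIntModEq p (hurwitzCoeff n e) (-((n : ℤ) + 1) * signedTree n) ∧
      IsIntModEq p (hurwitzCoeff n d) (-((n : ℤ) + 1) * signedTree n) := by
    intro n
    induction n using Nat.strong_induction_on with
    | _ n ih =>
      have hgn : IsIntModEq p (hurwitzCoeff n g) (signedTree n) := by
        cases n with
        | zero => exact ⟨1, by simp [hurwitzCoeff, hg], by simp [signedTree]⟩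
        | succ n =>
          rw [← hurwitzCoeff_derivative, hd, hurwitzCoeff_mul, signedTree_succ]
          refine IsIntModEq.sum fun i hi => ?_
          have hi : i < n + 1 := by simpa using hi
          exact ((hnat _).mul (ih i hi).1).mul (ih (n - i) (by lia)).2.2
      have hen : IsIntModEq p (hurwitzCoeff n e) (-((n : ℤ) + 1) * signedTree n) := by
        rw [hrec]
        have hsum := IsIntModEq.sum (p := p) (s := Finset.range n) fun i hi =>
          ((hnat (n.choose (i + 1))).mul ((hnat (i + 1)).mul (ih i (Finset.mem_range.1 hi)).1)).mul
            (ih (n - (i + 1)) (by have := Finset.mem_range.1 hi; lia)).2.1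
        simpa only [add_zero] using ((IsIntModEq.intCast p (-((n : ℤ) + 1))).mul hgn).add
          (IsIntModEq.natCast_mul_of_dvd hdvd ((IsIntModEq.intCast p (-1)).mul hsum))
      refine ⟨hgn, hen, ?_⟩
      rw [hde, hurwitzCoeff_add]
      simpa only [add_zero] using
        hen.add (IsIntModEq.hurwitzCoeff_X_pow_mul_expand hp hpm fun j hj => (ih j hj).2.2)
  exact (main n).1

end Integrality

end BottcherCoordinate

theorem theorem5 (p : ℕ) (hp : p.Prime) (φ : ℚ⟦X⟧)
    (hφ : φ = PowerSeries.X ^ (p ^ 2) +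
      PowerSeries.C ((p : ℚ) ^ 2) * PowerSeries.X ^ (p ^ 2 + 1)) :
    (∃! f : ℚ⟦X⟧, IsBottcherCoordinate (p ^ 2) φ f) ∧
    ∀ f : ℚ⟦X⟧, IsBottcherCoordinate (p ^ 2) φ f →
      ∃ a : ℕ → ℤ,
        f = PowerSeries.X * PowerSeries.mk (fun k => (a k : ℚ) / (k.factorial : ℚ)) ∧
        ∀ k : ℕ, (∃ r : ℕ, k = p ^ r) → a k ≡ -1 [ZMOD (p : ℤ)] := by
  have hpm : p + 1 ≤ p ^ 2 := by nlinarith [hp.two_le]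
  have hm : 2 ≤ p ^ 2 := by have := hp.two_le; lia
  have hmQ : ((p ^ 2 : ℕ) : ℚ) ≠ 0 := by exact_mod_cast (by lia : p ^ 2 ≠ 0)
  obtain rfl : φ = X ^ (p ^ 2) + C ((p ^ 2 : ℕ) : ℚ) * X ^ (p ^ 2 + 1) := by
    rw [hφ]; push_cast; rfl
  refine ⟨BottcherCoordinate.existsUnique_isBottcherCoordinate hm hmQ _, fun f hf => ?_⟩
  obtain ⟨g, rfl⟩ := BottcherCoordinate.exists_eq_X_mul hf
  obtain ⟨hg, hdef⟩ :=
    (BottcherCoordinate.isBottcherCoordinate_X_mul_iff (by lia : p ^ 2 ≠ 0) _ g).1 hf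
  choose a ha hmod using fun k => BottcherCoordinate.isIntModEq_hurwitzCoeff_signedTree
    hp.ne_zero hpm (dvd_pow_self p two_ne_zero) hg hdef k
  refine ⟨a, ?_, ?_⟩
  · congr 1
    ext k
    rw [coeff_mk, ← ha, BottcherCoordinate.hurwitzCoeff,
      mul_div_cancel_left₀ _ (by exact_mod_cast k.factorial_ne_zero)]
  · rintro _ ⟨r, rfl⟩
    exact (hmod _).trans (BottcherCoordinate.signedTree_prime_pow hp r)
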